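/- Conventions. A \emph{Fraïssé structure} is a countably infinite, locally finite, ultrahomogeneous structure in a countable language. A \emph{Fraïssé class} is a nonempty class of finite structures, countable up to isomorphism, containing structures of arbitrarily large finite size, with the hereditary, joint embedding and amalgamation properties. $\mathrm{Age}(\mathbf M)$ is the class of finitely generated structures that embed in $\mathbf M$. A structure is \emph{rigid} if its only automorphism is the identity. A class $\mathcal K$ has the \emph{Ramsey property} if for all $k\in\mathbb N$ and $\mathbf A,\mathbf B\in\mathcal K$ there is $\mathbf C\in\mathcal K$ such that for every colouring with $k$ colours of the substructures of $\mathbf C$ isomorphic to $\mathbf A$, there is a substructure $\widetilde{\mathbf B}\cong\mathbf B$ of $\mathbf C$ such that all the substructures of $\widetilde{\mathbf B}$ isomorphic to $\mathbf A$ have the same colour. Let $\mathbf F$ be a Fraïssé structure with universe $\mathbb N$ in a countable language $L$, let $L^*=L\cup\{R_i: i\in I\}$ with $I$ countable and each $R_i\notin L$ a relation symbol of arity $a(i)$, and let $\mathbf F^*=(\mathbf F,\vec R^*)$ be an expansion of $\mathbf F$ to $L^*$ which is itself a Fraïssé structure. Assume that $\mathbf F^*$ is a precompact expansion of $\mathbf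 F$, i.e. every $\mathbf A\in\mathrm{Age}(\mathbf F)$ has only finitely many expansions (on the same universe) in $\mathrm{Age}(\mathbf F^*)$. Let $G=\mathrm{Aut}(\mathbf F)$ act on $P^*=\prod_{i\in I}\{0,1\}^{\mathbb N^{a(i)}}$ by $(g\cdot\vec S)_i(y_1,\dots,y_{a(i)})\Leftrightarrow S_i(g^{-1}y_1,\dots,g^{-1}y_{a(i)})$. Equip $P^*$ with the distance $\sup_{i\in I} d_i$, where, for $S_i\ne T_i$, $d_i(S_i,T_i)=2^{-m}$ with $m$ least such that $S_i$ and $T_i$ differ on $\{0,\dots,m-1\}$, and $d_i(S_i,S_i)=0$. Let $X^*=\overline{G\cdot\vec R^*}\subseteq P^*$. Theorem. Assume that $\mathrm{Age}(\mathbf F^*)$ consists of rigid structures and has the Ramsey property. Then there is $\vec S\in X^*$ such that the action of $G$ on $\overline{G\cdot\vec S}$ is minimal (every point of $\overline{G\cdot\vec S}$ has dense orbit in it). Moreover, for every such $\vec S$, the class $\mathrm{Age}(\mathbf F,\vec S)$ is a subclass of $\mathrm{Age}(\mathbf F^*)$, is a Fraïssé class, has the Ramsey property, and has the expansion property relative to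 $\mathrm{Age}(\mathbf F)$: for every $\mathbf A\in\mathrm{Age}(\mathbf F)$ there is $\mathbf B\in\mathrm{Age}(\mathbf F)$ such that every expansion of $\mathbf A$ in $\mathrm{Age}(\mathbf F,\vec S)$ embeds in every expansion of $\mathbf B$ in $\mathrm{Age}(\mathbf F,\vec S)$. In particular $\mathrm{Age}(\mathbf F^*)$ admits a Fraïssé subclass with the Ramsey property and the expansion property relative to $\mathrm{Age}(\mathbf F)$. -/

import Mathlib

open FirstOrder

namespace RelExpansion

open FirstOrder.Language FirstOrder.Language.Structure CategoryTheory

universe u v u' v' w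

/-! ### Fraïssé structures, Fraïssé classes, rigidity, Ramsey property -/

section General

variable (L : FirstOrder.Language.{u, v})

/-- A Fraïssé structure: a countably infinite, locally finite, ultrahomogeneous structure. -/
structure IsFraisseStructure (M : Type w) [L.Structure M] : Prop where
  countable : Countable M
  infinite : Infinite M
  locallyFinite : ∀ S : L.Substructure M, S.FG → Finite S
  ultrahomogeneous : L.IsUltrahomogeneous M

variable {L}

/-- A Fraïssé class: a (nonempty, up to isomorphism countable) class of finite structures, of
arbitrarily large sizes, with the hereditary, joint embedding and amalgamation properties. -/
structure IsFraisseClass (K : Set (Bundled.{w} L.Structure)) : Prop where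
  isFraisse : IsFraisse K
  finite : ∀ A ∈ K, Finite A
  large : ∀ n : ℕ, ∃ A ∈ K, n ≤ Nat.card A

/-- The class `K` consists of rigid structures, i.e. structures with trivial automorphism group. -/
def ConsistsOfRigid (K : Set (Bundled.{w} L.Structure)) : Prop :=
  ∀ A ∈ K, ∀ φ : A ≃[L] A, φ = FirstOrder.Language.Equiv.refl L A

/-- The set of copies of `A` in `C`: the substructures of `C` that are isomorphic to `A`. -/
def copies (A C : Bundled.{w} L.Structure) : Set (L.Substructure C) :=
  {S | Nonempty (A ≃[L] S)}

/-- The arrow relation `C → (B)^A_k`: for every `k`-coloring of the copies of `A` in `C` there is a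
copy `B'` of `B` in `C` such that at most one color appears on the copies of `A` inside `B'`. -/
def Arrow (A B C : Bundled.{w} L.Structure) (k : ℕ) : Prop :=
  ∀ c : copies A C → Fin k, ∃ B' ∈ copies B C,
    (c '' {A' : copies A C | (A' : L.Substructure C) ≤ B'}).Subsingleton

/-- The Ramsey property of a class of structures. -/
def RamseyProperty (K : Set (Bundled.{w} L.Structure)) : Prop :=
  ∀ k : ℕ, ∀ A ∈ K, ∀ B ∈ K, ∃ C ∈ K, Arrow A B C k

end General

/-! ### Expansions by relation symbols

The expanded language is `L.sum L'`, where `L'` is relational. -/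

section Expansions

variable {L : FirstOrder.Language.{u, v}} {L' : FirstOrder.Language.{u', v'}}

/-- The set of all expansions of the `L`-structure `A` to the language `L.sum L'`, on the same
universe. -/
def expansionsOf (L' : FirstOrder.Language.{u', v'}) (A : Bundled.{w} L.Structure) :
    Set ((L.sum L').Structure A) :=
  {s | @LHom.reduct L (L.sum L') LHom.sumInl A s = A.str}

/-- Every structure in `K` has only finitely many expansions in `Kstar`. -/
def FinitelyManyExpansions (K : Set (Bundled.{w} L.Structure))
    (Kstar : Set (Bundled.{w} (L.sum L').Structure)) : Prop :=
  ∀ A ∈ K, {s ∈ expansionsOf L' A | Bundled.mk A s ∈ Kstar}.Finite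

/-- The expansion property of `Kstar` relative to `K`: for every `A ∈ K` there is `B ∈ K` such that
every expansion of `A` in `Kstar` embeds in every expansion of `B` in `Kstar`. -/
def ExpansionProperty (K : Set (Bundled.{w} L.Structure))
    (Kstar : Set (Bundled.{w} (L.sum L').Structure)) : Prop :=
  ∀ A ∈ K, ∃ B ∈ K, ∀ s ∈ expansionsOf L' A, ∀ t ∈ expansionsOf L' B,
    Bundled.mk A s ∈ Kstar → Bundled.mk B t ∈ Kstar →
      Nonempty (@FirstOrder.Language.Embedding (L.sum L') A B s t)

end Expansions

/-! ### The space of relational expansions of a structure with universe `ℕ` -/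

section Space

/-- The product, over all symbols `R` of `L'`, of the sets of all relations on `ℕ` whose arity is
the arity `i.1` of the symbol `i = ⟨i.1, R⟩`. -/
def RelSpace (L' : FirstOrder.Language.{u', v'}) : Type v' :=
  ∀ i : (Σ n, L'.Relations n), (Fin i.1 → ℕ) → Prop

/-- `S` and `T` have the same restriction to `[m] = {0, …, m - 1}`. -/
def AgreeBelow {a : ℕ} (m : ℕ) (S T : (Fin a → ℕ) → Prop) : Prop :=
  ∀ y : Fin a → ℕ, (∀ j, y j < m) → (S y ↔ T y)

theorem eq_of_agreeBelow {a : ℕ} {S T : (Fin a → ℕ) → Prop} (h : ∀ m, AgreeBelow m S T) :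
    S = T := by
  funext y
  refine propext (h (Finset.univ.sup y + 1) y fun j => ?_)
  exact Nat.lt_succ_of_le (Finset.le_sup (Finset.mem_univ j))

open Classical in
/-- The ultrametric on the set of `a`-ary relations on `ℕ`: `d(S, T) = 2⁻ᵐ`, where `m` is least such
that `S` and `T` have different restrictions to `[m]` (and `d(S, S) = 0`). -/
noncomputable def relDist {a : ℕ} (S T : (Fin a → ℕ) → Prop) : ℝ :=
  if S = T then 0 else (1 / 2 : ℝ) ^ sInf {m : ℕ | ¬ AgreeBelow m S T}

theorem relDist_nonneg {a : ℕ} (S T : (Fin a → ℕ) → Prop) : 0 ≤ relDist S T := by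
  unfold relDist
  split_ifs <;> positivity

theorem relDist_le_one {a : ℕ} (S T : (Fin a → ℕ) → Prop) : relDist S T ≤ 1 := by
  unfold relDist
  split_ifs
  · norm_num
  · exact pow_le_one₀ (by norm_num) (by norm_num)

theorem relDist_self {a : ℕ} (S : (Fin a → ℕ) → Prop) : relDist S S = 0 := by
  simp [relDist]

theorem relDist_comm {a : ℕ} (S T : (Fin a → ℕ) → Prop) : relDist S T = relDist T S := by
  have h : ∀ m, AgreeBelow m S T ↔ AgreeBelow m T S := fun m =>
    forall₂_congr fun _ _ => iff_comm
  by_cases hST : S = T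
  · rw [hST]
  · rw [relDist, relDist, if_neg hST, if_neg (Ne.symm hST)]
    simp only [h]

theorem eq_of_relDist {a : ℕ} {S T : (Fin a → ℕ) → Prop} (h : relDist S T = 0) : S = T := by
  by_contra hne
  rw [relDist, if_neg hne] at h
  exact absurd h (by positivity)

theorem relDist_triangle {a : ℕ} (S T U : (Fin a → ℕ) → Prop) :
    relDist S U ≤ relDist S T + relDist T U := by
  by_cases hST : S = T
  · subst hST
    simp [relDist_self]
  by_cases hTU : T = U
  · subst hTU
    simp [relDist_self]
  by_cases hSU : S = U
  · subst hSU
    rw [relDist_self]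
    exact add_nonneg (relDist_nonneg _ _) (relDist_nonneg _ _)
  have hne : {m : ℕ | ¬ AgreeBelow m S U}.Nonempty := by
    by_contra hc
    exact hSU (eq_of_agreeBelow fun m => by
      by_contra hm
      exact hc ⟨m, hm⟩)
  have hmem := Nat.sInf_mem hne
  set m := sInf {m : ℕ | ¬ AgreeBelow m S U} with hm
  have hor : ¬ AgreeBelow m S T ∨ ¬ AgreeBelow m T U := by
    by_contra hc
    push Not at hc
    exact hmem fun y hy => (hc.1 y hy).trans (hc.2 y hy)
  have key : ∀ V W : (Fin a → ℕ) → Prop, V ≠ W → ¬ AgreeBelow m V W →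
      (1 / 2 : ℝ) ^ m ≤ relDist V W := by
    intro V W hVW hV
    rw [relDist, if_neg hVW]
    exact pow_le_pow_of_le_one (by norm_num) (by norm_num) (Nat.sInf_le hV)
  have hd : relDist S U = (1 / 2 : ℝ) ^ m := by rw [relDist, if_neg hSU]
  rw [hd]
  rcases hor with h | h
  · exact (key S T hST h).trans (le_add_of_nonneg_right (relDist_nonneg _ _))
  · exact (key T U hTU h).trans (le_add_of_nonneg_left (relDist_nonneg _ _))

variable {L' : FirstOrder.Language.{u', v'}}

/-- The supremum distance on `RelSpace L'`. -/
noncomputable def supDist (S T : RelSpace L') : ℝ := ⨆ i, relDist (S i) (T i)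

theorem bddAbove_relDist (S T : RelSpace L') :
    BddAbove (Set.range fun i => relDist (S i) (T i)) :=
  ⟨1, by rintro _ ⟨i, rfl⟩; exact relDist_le_one _ _⟩

theorem relDist_le_supDist (S T : RelSpace L') (i : Σ n, L'.Relations n) :
    relDist (S i) (T i) ≤ supDist S T :=
  le_ciSup (bddAbove_relDist S T) i

/-- `RelSpace L'` with the supremum distance; its topology is the one used throughout. -/
noncomputable instance : MetricSpace (RelSpace L') where
  dist := supDist
  dist_self S := by
    change (⨆ i, relDist (S i) (S i)) = 0
    simp [relDist_self]
  dist_comm S T := by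
    change (⨆ i, relDist (S i) (T i)) = ⨆ i, relDist (T i) (S i)
    simp only [relDist_comm]
  dist_triangle S T U := by
    refine Real.iSup_le (fun i => ?_) (add_nonneg (Real.iSup_nonneg fun i => relDist_nonneg _ _)
      (Real.iSup_nonneg fun i => relDist_nonneg _ _))
    exact (relDist_triangle (S i) (T i) (U i)).trans
      (add_le_add (relDist_le_supDist S T i) (relDist_le_supDist T U i))
  eq_of_dist_eq_zero {S T} h := by
    funext i
    exact eq_of_relDist
      (le_antisymm ((relDist_le_supDist S T i).trans_eq h) (relDist_nonneg _ _))

/-- The logic action of the permutations of `ℕ`: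
`(g • S) i (y₁, …, yₙ) ↔ S i (g⁻¹ y₁, …, g⁻¹ yₙ)`. -/
instance : MulAction (Equiv.Perm ℕ) (RelSpace L') where
  smul g S := fun i y => S i fun j => g⁻¹ (y j)
  one_smul _ := rfl
  mul_smul _ _ _ := rfl

variable (L : FirstOrder.Language.{u, v}) [L.Structure ℕ]

/-- The automorphism group of an `L`-structure with universe `ℕ`, as a group of permutations. -/
def autGroup : Subgroup (Equiv.Perm ℕ) where
  carrier := {g | ∃ φ : ℕ ≃[L] ℕ, φ.toEquiv = g}
  one_mem' := ⟨FirstOrder.Language.Equiv.refl L ℕ, rfl⟩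
  mul_mem' := by
    rintro _ _ ⟨φ, rfl⟩ ⟨ψ, rfl⟩
    exact ⟨φ.comp ψ, rfl⟩
  inv_mem' := by
    rintro _ ⟨φ, rfl⟩
    exact ⟨φ.symm, rfl⟩

/-- The expansion `(F, S)` of the `L`-structure `F` with universe `ℕ` by the relations `S`. -/
def expand (S : RelSpace L') [L'.IsRelational] : Bundled.{0} (L.sum L').Structure :=
  ⟨ℕ, @sumStructure L L' ℕ _ ⟨fun f => isEmptyElim f, fun R => S ⟨_, R⟩⟩⟩

/-- The closure of the orbit of `S` under the automorphism group of the `L`-structure on `ℕ`. -/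
def orbitClosure (S : RelSpace L') : Set (RelSpace L') :=
  closure (MulAction.orbit (autGroup L) S)

/-- The action on the orbit closure of `S` is minimal: each of its points has dense orbit in it. -/
def IsMinimalOrbitClosure (S : RelSpace L') : Prop :=
  ∀ T ∈ orbitClosure L S, orbitClosure L T = orbitClosure L S

end Space

end RelExpansion

open RelExpansion

namespace RelExpansion

open FirstOrder.Language FirstOrder.Language.Structure CategoryTheory Filter

/-! ### Families of relations, pullbacks and traces -/

/-! Everything is read off from traces, the patterns that a family of relations leaves along
embeddings of finite `L`-structures. The age of `(F, S)` amounts to the traces of `S`, and `T` is in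
the orbit closure of `S` exactly when every trace of `T` is a trace of `S` (`mem_orbitClosure_iff`).
Precompactness leaves each finite structure finitely many traces, so ultralimits below `R` are
eventually constant along each finite structure and can replace compactness. They give the bounds
for Zorn's lemma (`exists_minimal_below`) and, with minimality, the expansion property
(`exists_initialSegment_expansion`).

It remains to carry amalgamation and Ramsey from `R` to a minimal `S`. In the spirit of
Kechris–Pestov–Todorcevic, Ramsey with rigidity yields a `T` in the orbit closure of `S` fixed by
`Aut(F*)` (`exists_invariant_below`). By homogeneity of `F*`, the trace of `T` along an embedding
depends only on that of `R`, so `T` induces a map from traces of `R` to traces of `S`. On the traces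
of `S` this map is onto by the expansion property, hence a permutation by finiteness
(`pull_eq_of_pull_invariant_eq`). Problems about traces of `S` are thereby solved in `R` and read
back through `T`. -/

/-- A family of relations on `A`, indexed by the relation symbols of `L'`. -/
abbrev RelFamily (L' : FirstOrder.Language) (A : Type) : Type _ :=
  ∀ i : (Σ n, L'.Relations n), (Fin i.1 → A) → Prop

variable {L : FirstOrder.Language} {L' : FirstOrder.Language}

/-- The pullback of a family of relations along a map. -/
def pull {A B : Type} (f : A → B) (S : RelFamily L' B) : RelFamily L' A :=
  fun i y => S i (f ∘ y)

theorem pull_comp {A B C : Type} (g : B → C) (f : A → B) (S : RelFamily L' C) :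
    pull (g ∘ f) S = pull f (pull g S) := rfl

theorem pull_embedding_comp {A B C : Type} [L.Structure A] [L.Structure B] [L.Structure C]
    (g : B ↪[L] C) (f : A ↪[L] B) (S : RelFamily L' C) :
    pull (g.comp f) S = pull f (pull g S) := rfl

variable (L) in
/-- The families of relations on `A` induced by `S` along the embeddings of `A`. -/
def traces [L.Structure ℕ] (S : RelFamily L' ℕ) (A : Type) [L.Structure A] :
    Set (RelFamily L' A) :=
  Set.range fun a : A ↪[L] ℕ => pull a S

variable (L) in
/-- `T` is below `S` if every trace of `T` on a finite structure is a trace of `S`. -/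
def Below [L.Structure ℕ] (T S : RelFamily L' ℕ) : Prop :=
  ∀ (A : Type) [L.Structure A] [Finite A], traces L T A ⊆ traces L S A

section Core

variable [L.Structure ℕ]

theorem Below.refl (S : RelFamily L' ℕ) : Below L S S := fun _ _ _ => subset_rfl

theorem Below.trans {S T U : RelFamily L' ℕ} (h : Below L S T) (h' : Below L T U) :
    Below L S U := fun A _ _ => (h A).trans (h' A)

theorem mem_traces {S : RelFamily L' ℕ} {A : Type} [L.Structure A] (a : A ↪[L] ℕ) :
    pull a S ∈ traces L S A := ⟨a, rfl⟩

theorem pull_mem_traces {S : RelFamily L' ℕ} {A B : Type} [L.Structure A] [L.Structure B]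
    (f : A ↪[L] B) {β : RelFamily L' B} (h : β ∈ traces L S B) : pull f β ∈ traces L S A := by
  obtain ⟨b, rfl⟩ := h
  exact ⟨b.comp f, rfl⟩

theorem below_pull_equiv (g : ℕ ≃[L] ℕ) (S : RelFamily L' ℕ) : Below L (pull g S) S := by
  rintro A _ _ _ ⟨a, rfl⟩
  exact ⟨g.toEmbedding.comp a, rfl⟩

/-- The substructure generated by `{0, …, m - 1}`. -/
abbrev initialSegment (L : FirstOrder.Language) [L.Structure ℕ] (m : ℕ) : L.Substructure ℕ :=
  Substructure.closure L (Set.Iio m)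

theorem mem_initialSegment {m n : ℕ} (h : n < m) : n ∈ initialSegment L m :=
  Substructure.subset_closure h

theorem IsFraisseStructure.finite_closure (hF : IsFraisseStructure L ℕ) {s : Set ℕ}
    (hs : s.Finite) : Finite (Substructure.closure L s) :=
  hF.locallyFinite _ (Substructure.fg_closure hs)

theorem IsFraisseStructure.finite_initialSegment (hF : IsFraisseStructure L ℕ) (m : ℕ) :
    Finite (initialSegment L m) :=
  hF.finite_closure (Set.finite_Iio m)

/-! ### Ultralimits -/

/-- The limit of a sequence of families of relations along an ultrafilter. -/
def ultralimit {ι : Type*} (𝓤 : Ultrafilter ι) (T : ι → RelFamily L' ℕ) : RelFamily L' ℕ :=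
  fun i y => ∀ᶠ j in (𝓤 : Filter ι), T j i y

/-- All finite structures have finitely many traces. -/
def FiniteTraces (L : FirstOrder.Language) [L.Structure ℕ] (R : RelFamily L' ℕ) : Prop :=
  ∀ (A : Type) [L.Structure A] [Finite A], (traces L R A).Finite

theorem eventually_eq_of_finite {ι β : Type*} (𝓤 : Ultrafilter ι) {s : Set β} (hs : s.Finite)
    {f : ι → β} (h : ∀ᶠ j in (𝓤 : Filter ι), f j ∈ s) :
    ∃ b ∈ s, ∀ᶠ j in (𝓤 : Filter ι), f j = b := by
  have := (Ultrafilter.finite_biUnion_mem_iff (f := 𝓤) (s := fun b => {j | f j = b}) hs).1 (by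
    filter_upwards [h] with j hj
    simpa using hj)
  exact this

/-- Along `a` only finitely many traces are possible, so the ultrafilter selects one. This fixes all
relation symbols simultaneously, even if there are infinitely many. -/
theorem eventually_pull_eq_ultralimit {ι : Type*} {R : RelFamily L' ℕ} (hfin : FiniteTraces L R)
    (𝓤 : Ultrafilter ι) {T : ι → RelFamily L' ℕ}
    (h : ∀ᶠ j in (𝓤 : Filter ι), Below L (T j) R) {A : Type} [L.Structure A] [Finite A]
    (a : A ↪[L] ℕ) :
    ∀ᶠ j in (𝓤 : Filter ι), pull a (T j) = pull a (ultralimit 𝓤 T) := by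
  obtain ⟨α, -, hα⟩ := eventually_eq_of_finite 𝓤 (hfin A) (f := fun j => pull a (T j))
    (h.mono fun j hj => hj A (mem_traces a))
  have : α = pull a (ultralimit 𝓤 T) := by
    funext i y
    refine propext ⟨fun hy => ?_, fun hy => ?_⟩
    · change ∀ᶠ j in (𝓤 : Filter ι), T j i (a ∘ y)
      filter_upwards [hα] with j hj
      subst hj
      exact hy
    · have hy' : ∀ᶠ j in (𝓤 : Filter ι), T j i (a ∘ y) := hy
      obtain ⟨j, h1, h2⟩ := (hα.and hy').exists
      rw [← h1]
      exact h2
  rwa [this] at hα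

theorem ultralimit_below {ι : Type*} {R S : RelFamily L' ℕ} (hfin : FiniteTraces L R)
    (hSR : Below L S R) (𝓤 : Ultrafilter ι) {T : ι → RelFamily L' ℕ}
    (h : ∀ᶠ j in (𝓤 : Filter ι), Below L (T j) S) : Below L (ultralimit 𝓤 T) S := by
  rintro A _ _ _ ⟨a, rfl⟩
  obtain ⟨j, h1, h2⟩ := ((eventually_pull_eq_ultralimit hfin 𝓤
    (h.mono fun j hj => hj.trans hSR) a).and h).exists
  change pull a (ultralimit 𝓤 T) ∈ _
  rw [← h1]
  exact h2 A (mem_traces a)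

/-! ### Minimal families of relations and the expansion property -/

theorem exists_minimal_below {R : RelFamily L' ℕ} (hfin : FiniteTraces L R) :
    ∃ S, Below L S R ∧ ∀ T, Below L T S → Below L S T := by
  -- The order is reversed: upper bounds and maximal elements for `r` are lower bounds and minimal
  -- elements for `Below`.
  let r : {S : RelFamily L' ℕ // Below L S R} → {S : RelFamily L' ℕ // Below L S R} → Prop :=
    fun S T => Below L T.1 S.1
  have key : ∀ c : Set {S : RelFamily L' ℕ // Below L S R}, IsChain r c →
      ∃ ub, ∀ a ∈ c, r a ub := by
    intro c hc
    rcases c.eq_empty_or_nonempty with rfl | hne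
    · exact ⟨⟨R, Below.refl R⟩, by simp⟩
    have : Nonempty c := hne.to_subtype
    have hdir : Directed (· ≥ ·) fun S : c => 𝓟 {T : c | r S T} := by
      intro S T
      rcases eq_or_ne S.1 T.1 with h | h
      · obtain rfl := Subtype.ext h
        exact ⟨S, le_rfl, le_rfl⟩
      rcases hc S.2 T.2 h with h | h
      · exact ⟨T, principal_mono.2 fun U (hU : r T U) => Below.trans hU h, le_rfl⟩
      · exact ⟨S, le_rfl, principal_mono.2 fun U (hU : r S U) => Below.trans hU h⟩
    have : NeBot (⨅ S : c, 𝓟 {T : c | r S T}) :=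
      iInf_neBot_of_directed hdir fun S => principal_neBot_iff.2 ⟨S, Below.refl S.1.1⟩
    set 𝓤 := Ultrafilter.of (⨅ S : c, 𝓟 {T : c | r S T})
    have h𝓤 : ∀ S : c, ∀ᶠ T in (𝓤 : Filter c), Below L T.1.1 S.1.1 := fun S =>
      Ultrafilter.of_le _ (mem_iInf_of_mem S (mem_principal_self _))
    refine ⟨⟨ultralimit 𝓤 fun T : c => T.1.1, ?_⟩, fun S hS => ?_⟩
    · exact ultralimit_below hfin (Below.refl R) 𝓤 (.of_forall fun T => T.1.2)
    · exact ultralimit_below hfin S.2 𝓤 (h𝓤 ⟨S, hS⟩)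
  obtain ⟨S, hS⟩ := exists_maximal_of_chains_bounded key fun h h' => Below.trans h' h
  exact ⟨S.1, S.2, fun T hT => hS ⟨T, hT.trans S.2⟩ hT⟩

/-- Otherwise, translate `S` so that a bad trace sits on each initial segment itself. The ultralimit
of the translates is below `S`, so by minimality it realises the trace of `A` that is missed for
almost all `n`; this copy already lies in one of those initial segments. -/
theorem exists_initialSegment_expansion (hF : IsFraisseStructure L ℕ) {R S : RelFamily L' ℕ}
    (hfin : FiniteTraces L R) (hSR : Below L S R) (hmin : ∀ T, Below L T S → Below L S T)
    (A : Type) [L.Structure A] [Finite A] :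
    ∃ n, ∀ α ∈ traces L S A, ∀ β ∈ traces L S (initialSegment L n),
      ∃ f : A ↪[L] initialSegment L n, pull f β = α := by
  by_contra! hcon
  choose α hα β hβ hne using hcon
  have hext : ∀ n, ∃ g : ℕ ≃[L] ℕ, pull (initialSegment L n).subtype (pull g S) = β n := by
    intro n
    obtain ⟨b, hb⟩ := hβ n
    obtain ⟨g, rfl⟩ := hF.ultrahomogeneous _ (Substructure.fg_closure (Set.finite_Iio n)) b
    exact ⟨g, hb⟩
  choose g hg using hext
  set 𝓤 := hyperfilter ℕ
  have hbelow : ∀ n, Below L (pull (g n) S) S := fun n => below_pull_equiv _ _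
  obtain ⟨α₀, hα₀, hev⟩ := eventually_eq_of_finite 𝓤 ((hfin A).subset (hSR A))
    (.of_forall hα)
  obtain ⟨a, ha⟩ := hmin _ (ultralimit_below hfin hSR 𝓤 (.of_forall hbelow)) A hα₀
  have hev' := eventually_pull_eq_ultralimit hfin 𝓤
    (.of_forall fun n => (hbelow n).trans hSR) a
  obtain ⟨m, hm⟩ := (Set.finite_range a).bddAbove
  have hlarge : ∀ᶠ n in (𝓤 : Filter ℕ), m < n :=
    Nat.hyperfilter_le_atTop (eventually_gt_atTop m)
  obtain ⟨n, ⟨h1, h2⟩, h3⟩ := ((hev.and hev').and hlarge).exists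
  refine hne n (a.codRestrict _ fun x =>
    mem_initialSegment ((hm (Set.mem_range_self x)).trans_lt h3)) ?_
  rw [h1, ← ha, ← hg]
  exact h2

/-! ### Invariant families of relations -/

/-- Ultrahomogeneity of the expansion of `ℕ` by `R`. -/
def Homogeneous (L : FirstOrder.Language) [L.Structure ℕ] (R : RelFamily L' ℕ) : Prop :=
  ∀ (A : Type) [L.Structure A] [Finite A] (a a' : A ↪[L] ℕ), pull a R = pull a' R →
    ∃ g : ℕ ≃[L] ℕ, pull g R = R ∧ ∀ x, a' x = g (a x)

/-- The Ramsey property for the traces of `R`, with colorings of embeddings, where the witnesses are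
the traces of `T`. -/
def EmbeddingRamsey (L : FirstOrder.Language) [L.Structure ℕ] (R T : RelFamily L' ℕ) : Prop :=
  ∀ (A B : Type) [L.Structure A] [L.Structure B] [Finite A] [Finite B],
    ∀ α ∈ traces L R A, ∀ β ∈ traces L R B, ∀ k : ℕ,
    ∃ (C : Type) (_ : L.Structure C) (_ : Finite C) (c : C ↪[L] ℕ), ∀ χ : (A ↪[L] C) → Fin k,
      ∃ b : B ↪[L] C, pull (c.comp b) T = β ∧ ∀ f f' : A ↪[L] B,
        pull f β = α → pull f' β = α → χ (b.comp f) = χ (b.comp f')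

/-- Color copies of `A` by the trace of `S` on them. A monochromatic copy of `B` is the image of `B`
under an automorphism `h` of `F`, and pulling `S` back by `h` makes the trace on `A` the same as on
each `g A`. -/
theorem exists_invariant_on {R S : RelFamily L' ℕ} (hF : IsFraisseStructure L ℕ)
    (hfin : FiniteTraces L R) (hhom : Homogeneous L R) (hRam : EmbeddingRamsey L R R)
    (hSR : Below L S R) (A : L.Substructure ℕ) [Finite A]
    (s : Finset {g : ℕ ≃[L] ℕ // pull g R = R}) :
    ∃ T, Below L T S ∧ ∀ g ∈ s, pull (A.subtype : A → ℕ) (pull g.1 T) = pull A.subtype T := by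
  set B := Substructure.closure L ((A : Set ℕ) ∪ ⋃ g ∈ s, g.1 '' (A : Set ℕ))
  have hBfin : Finite B := hF.finite_closure
    ((Set.toFinite _).union (s.finite_toSet.biUnion fun g _ => (Set.toFinite _).image _))
  have : Finite (traces L R A) := (hfin A).to_subtype
  obtain ⟨k, ⟨e⟩⟩ := Finite.exists_equiv_fin (traces L R A)
  obtain ⟨C, _, _, c, hc⟩ := hRam A B _ (mem_traces A.subtype) _ (mem_traces B.subtype) k
  obtain ⟨b, hb, hb'⟩ := hc fun f => e ⟨pull (c.comp f) S, hSR A (mem_traces _)⟩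
  obtain ⟨h, -, hh⟩ := hhom B B.subtype (c.comp b) hb.symm
  have hh' : (c.comp b : B → ℕ) = h ∘ B.subtype := funext hh
  refine ⟨pull h S, below_pull_equiv _ _, fun g hg => ?_⟩
  have h0 : ∀ x : A, A.subtype x ∈ B := fun x => Substructure.subset_closure (Or.inl x.2)
  have h1 : ∀ x : A, (g.1.toEmbedding.comp A.subtype) x ∈ B := fun x =>
    Substructure.subset_closure (Or.inr (Set.mem_biUnion hg ⟨x, x.2, rfl⟩))
  have := hb' ((g.1.toEmbedding.comp A.subtype).codRestrict B h1) (A.subtype.codRestrict B h0)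
    (congrArg (pull A.subtype) g.2) rfl
  have := congrArg Subtype.val (e.injective this)
  simp only [← Embedding.comp_assoc, pull_embedding_comp _ (Embedding.codRestrict _ _ _),
    hh'] at this
  exact this

/-- A limit over pairs (initial segment, finite set of automorphisms): each tuple and each
automorphism is eventually covered. -/
theorem exists_invariant_below {R S : RelFamily L' ℕ} (hF : IsFraisseStructure L ℕ)
    (hfin : FiniteTraces L R) (hhom : Homogeneous L R) (hRam : EmbeddingRamsey L R R)
    (hSR : Below L S R) :
    ∃ T, Below L T S ∧ ∀ g : ℕ ≃[L] ℕ, pull g R = R → pull g T = T := by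
  classical
  have hseg := hF.finite_initialSegment
  choose T hT hinv using fun j : ℕ × Finset {g : ℕ ≃[L] ℕ // pull g R = R} =>
    exists_invariant_on hF hfin hhom hRam hSR (initialSegment L j.1) j.2
  set 𝓤 := Ultrafilter.of (atTop : Filter (ℕ × Finset {g : ℕ ≃[L] ℕ // pull g R = R}))
  refine ⟨ultralimit 𝓤 T, ultralimit_below hfin hSR 𝓤 (.of_forall hT), fun g hg => ?_⟩
  funext i y
  refine propext (eventually_congr ?_)
  obtain ⟨m, hm⟩ := (Set.finite_range y).bddAbove
  have hev : ∀ᶠ j in (𝓤 : Filter (ℕ × Finset {g : ℕ ≃[L] ℕ // pull g R = R})),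
      (m + 1, {⟨g, hg⟩}) ≤ j :=
    Ultrafilter.of_le _ (eventually_ge_atTop _)
  filter_upwards [hev] with j hj
  have := congrFun (congrFun (hinv j ⟨g, hg⟩ (by simpa using hj.2)) i) fun x =>
    ⟨y x, mem_initialSegment (((hm (Set.mem_range_self x)).trans_lt m.lt_succ_self).trans_le
      hj.1)⟩
  exact this.to_iff

/-! ### The permutation of traces induced by an invariant family -/

section Permutation

variable {R S T : RelFamily L' ℕ}

theorem pull_eq_of_invariant (hhom : Homogeneous L R)
    (hT : ∀ g : ℕ ≃[L] ℕ, pull g R = R → pull g T = T) {A : Type} [L.Structure A] [Finite A]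
    {a a' : A ↪[L] ℕ} (h : pull a R = pull a' R) : pull a T = pull a' T := by
  obtain ⟨g, hg, hga⟩ := hhom A a a' h
  have : (a' : A → ℕ) = g ∘ a := funext hga
  rw [this, pull_comp, hT g hg]

variable (hF : IsFraisseStructure L ℕ) (hfin : FiniteTraces L R) (hhom : Homogeneous L R)
  (hSR : Below L S R) (hmin : ∀ T, Below L T S → Below L S T) (hTS : Below L T S)
  (hT : ∀ g : ℕ ≃[L] ℕ, pull g R = R → pull g T = T)

include hF hfin hSR hmin hTS in
-- Place in `R` a copy of a trace of `S` on a large initial segment. The trace of `T` there is one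
-- of `S`, so by the expansion property it contains `α`.
theorem exists_pull_invariant_eq {A : Type} [L.Structure A] [Finite A] {α : RelFamily L' A}
    (hα : α ∈ traces L S A) : ∃ a : A ↪[L] ℕ, pull a R ∈ traces L S A ∧ pull a T = α := by
  obtain ⟨n, hn⟩ := exists_initialSegment_expansion hF hfin hSR hmin A
  have := hF.finite_initialSegment n
  have hβ : pull (initialSegment L n).subtype S ∈ traces L S (initialSegment L n) := mem_traces _
  obtain ⟨b, hb⟩ := hSR _ hβ
  obtain ⟨f, hf⟩ := hn α hα (pull b T) (hTS _ (mem_traces b))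
  refine ⟨b.comp f, ?_, hf⟩
  have := pull_mem_traces f hβ
  rwa [← hb] at this

include hF hfin hhom hSR hmin hTS hT in
theorem pull_eq_of_pull_invariant_eq {A : Type} [L.Structure A] [Finite A] {a a' : A ↪[L] ℕ}
    (ha : pull a R ∈ traces L S A) (ha' : pull a' R ∈ traces L S A)
    (h : pull a T = pull a' T) : pull a R = pull a' R := by
  have : Finite (traces L S A) := ((hfin A).subset (hSR A)).to_subtype
  choose lift hlift using fun α : traces L S A => hSR A α.2
  -- The map induced by `T`; by invariance the chosen copy `lift α` of `α` in `R` is immaterial.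
  let Φ : traces L S A → traces L S A := fun α => ⟨pull (lift α) T, hTS A (mem_traces _)⟩
  have hΦ : ∀ (a : A ↪[L] ℕ) (ha : pull a R ∈ traces L S A), (Φ ⟨_, ha⟩).1 = pull a T :=
    fun a ha => pull_eq_of_invariant hhom hT (hlift ⟨_, ha⟩)
  have hsurj : Function.Surjective Φ := by
    rintro ⟨α, hα⟩
    obtain ⟨a, ha, rfl⟩ := exists_pull_invariant_eq hF hfin hSR hmin hTS hα
    exact ⟨⟨_, ha⟩, Subtype.ext (hΦ a ha)⟩
  have := Finite.injective_iff_surjective.2 hsurj (a₁ := ⟨_, ha⟩) (a₂ := ⟨_, ha'⟩)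
    (Subtype.ext (by rw [hΦ, hΦ, h]))
  exact congrArg Subtype.val this

include hF hfin hhom hSR hmin hTS hT in
-- Injectivity of the induced map makes the two copies of `A` agree for `R`; an automorphism of `(F,
-- R)`, which fixes `T`, then superposes them.
theorem exists_amalgam {A B C : Type} [L.Structure A] [L.Structure B] [L.Structure C]
    [Finite A] [Finite B] [Finite C] (f : A ↪[L] B) (h : A ↪[L] C)
    {β : RelFamily L' B} {γ : RelFamily L' C} (hβ : β ∈ traces L S B) (hγ : γ ∈ traces L S C)
    (hfh : pull f β = pull h γ) :
    ∃ (b : B ↪[L] ℕ) (c : C ↪[L] ℕ), pull b T = β ∧ pull c T = γ ∧ b.comp f = c.comp h := by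
  obtain ⟨b, hb, rfl⟩ := exists_pull_invariant_eq hF hfin hSR hmin hTS hβ
  obtain ⟨c, hc, rfl⟩ := exists_pull_invariant_eq hF hfin hSR hmin hTS hγ
  have := pull_eq_of_pull_invariant_eq hF hfin hhom hSR hmin hTS hT (a := b.comp f)
    (a' := c.comp h) (pull_mem_traces f hb) (pull_mem_traces h hc) hfh
  obtain ⟨g, hg, hgx⟩ := hhom A _ _ this
  refine ⟨g.toEmbedding.comp b, c, ?_, rfl, ?_⟩
  · change pull b (pull g T) = _
    rw [hT g hg]
  · ext x
    exact (hgx x).symm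

include hF hfin hhom hSR hmin hTS hT in
theorem embeddingRamsey_of_invariant (hRam : EmbeddingRamsey L R R) : EmbeddingRamsey L S T := by
  intro A B _ _ _ _ α hα β hβ k
  obtain ⟨a, ha, rfl⟩ := exists_pull_invariant_eq hF hfin hSR hmin hTS hα
  obtain ⟨b, hb, rfl⟩ := exists_pull_invariant_eq hF hfin hSR hmin hTS hβ
  obtain ⟨C, _, _, c, hc⟩ := hRam A B _ (mem_traces a) _ (mem_traces b) k
  refine ⟨C, _, ‹_›, c, fun χ => ?_⟩
  obtain ⟨d, hd, hχ⟩ := hc χ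
  have key : ∀ f : A ↪[L] B, pull f (pull b T) = pull a T → pull f (pull b R) = pull a R :=
    fun f hf => pull_eq_of_pull_invariant_eq hF hfin hhom hSR hmin hTS hT (a := b.comp f)
      (pull_mem_traces f hb) ha hf
  exact ⟨d, pull_eq_of_invariant hhom hT hd, fun f f' hf hf' => hχ f f' (key f hf) (key f' hf')⟩

end Permutation

end Core

/-! ### Colorings of copies and colorings of embeddings -/

section Arrow

variable {L : FirstOrder.Language} {A B C : Bundled.{0} L.Structure} {k : ℕ}

/-- By rigidity each copy of `A` is the range of exactly one embedding, so coloring embeddings is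
coloring copies. -/
theorem Arrow.exists_embedding (hA : ∀ φ : A ≃[L] A, φ = FirstOrder.Language.Equiv.refl L A)
    (h : Arrow A B C k) (χ : (A ↪[L] C) → Fin k) :
    ∃ b : B ↪[L] C, ∀ f f' : A ↪[L] B, χ (b.comp f) = χ (b.comp f') := by
  have hiso : ∀ S : copies A C, Nonempty (A ≃[L] S.1) := fun S => S.2
  let iso := fun S => (hiso S).some
  obtain ⟨B', ⟨φ⟩, hB'⟩ := h fun S => χ (S.1.subtype.comp (iso S).toEmbedding)
  refine ⟨B'.subtype.comp φ.toEmbedding, fun f f' => ?_⟩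
  have key : ∀ f : A ↪[L] B, ∃ S : copies A C, S.1 ≤ B' ∧
      S.1.subtype.comp (iso S).toEmbedding = (B'.subtype.comp φ.toEmbedding).comp f := by
    intro f
    set e := (B'.subtype.comp φ.toEmbedding).comp f
    let S : copies A C := ⟨e.toHom.range, ⟨e.equivRange⟩⟩
    refine ⟨S, ?_, ?_⟩
    · rintro _ ⟨x, rfl⟩
      exact (φ (f x)).2
    · ext x
      have h1 : e.equivRange.symm (iso S x) = x :=
        DFunLike.congr_fun (hA (e.equivRange.symm.comp (iso S))) x
      have h2 : iso S x = e.equivRange x :=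
        (e.equivRange.apply_symm_apply (iso S x)).symm.trans (congrArg _ h1)
      exact congrArg Subtype.val h2
  obtain ⟨S, hS, hSe⟩ := key f
  obtain ⟨S', hS', hSe'⟩ := key f'
  rw [← hSe, ← hSe']
  exact hB' ⟨S, hS, rfl⟩ ⟨S', hS', rfl⟩

theorem arrow_of_forall_embedding
    (h : ∀ χ : (A ↪[L] C) → Fin k, ∃ b : B ↪[L] C,
      ∀ f f' : A ↪[L] B, χ (b.comp f) = χ (b.comp f')) : Arrow A B C k := by
  intro c
  obtain ⟨b, hb⟩ := h fun e => c ⟨e.toHom.range, ⟨e.equivRange⟩⟩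
  refine ⟨b.toHom.range, ⟨b.equivRange⟩, ?_⟩
  have key : ∀ S : copies A C, S.1 ≤ b.toHom.range → ∃ f : A ↪[L] B,
      S = ⟨(b.comp f).toHom.range, ⟨(b.comp f).equivRange⟩⟩ := by
    rintro ⟨S, ⟨ψ⟩⟩ hS
    let f := b.equivRange.symm.toEmbedding.comp
      ((Substructure.inclusion hS).comp ψ.toEmbedding)
    have hf : ∀ x, b (f x) = ψ x := fun x =>
      congrArg Subtype.val (b.equivRange.apply_symm_apply (Substructure.inclusion hS (ψ x)))
    refine ⟨f, Subtype.ext (SetLike.ext fun y => ⟨fun hy => ?_, ?_⟩)⟩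
    · refine ⟨ψ.symm ⟨y, hy⟩, ?_⟩
      exact (hf _).trans (congrArg Subtype.val (ψ.apply_symm_apply ⟨y, hy⟩))
    · rintro ⟨x, rfl⟩
      exact (hf x).symm ▸ (ψ x).2
  rintro _ ⟨S, hS, rfl⟩ _ ⟨S', hS', rfl⟩
  obtain ⟨f, rfl⟩ := key S hS
  obtain ⟨f', rfl⟩ := key S' hS'
  exact hb f f'

end Arrow

/-! ### Structures in the expanded language -/

section Translation

variable {L : FirstOrder.Language} {L' : FirstOrder.Language} [L'.IsRelational]

/-- The structure in the expanded language given by an `L`-structure and a family of relations. -/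
@[reducible]
def relExpansion {A : Type} [L.Structure A] (s : RelFamily L' A) : (L.sum L').Structure A :=
  @sumStructure L L' A _ ⟨fun f => isEmptyElim f, fun R => s ⟨_, R⟩⟩

variable (L) in
/-- The bundled version of `relExpansion`. -/
def withRelations (A : Type) [L.Structure A] (s : RelFamily L' A) :
    Bundled.{0} (L.sum L').Structure :=
  ⟨A, relExpansion s⟩

theorem relExpansion_injective {A : Type} [L.Structure A] :
    Function.Injective (relExpansion : RelFamily L' A → (L.sum L').Structure A) := by
  intro s t h
  funext ⟨n, R⟩ y
  exact congrArg (fun S : (L.sum L').Structure A => @RelMap _ _ S n (Sum.inr R) y) h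

theorem relExpansion_mem_expansionsOf (A : Bundled.{0} L.Structure) (s : RelFamily L' A) :
    relExpansion s ∈ expansionsOf L' A := rfl

theorem exists_eq_relExpansion (A : Bundled.{0} L.Structure) {s : (L.sum L').Structure A}
    (hs : s ∈ expansionsOf L' A) : ∃ α : RelFamily L' A, s = relExpansion α := by
  refine ⟨fun i y => @RelMap _ _ s i.1 (Sum.inr i.2) y, ?_⟩
  refine Structure.ext ?_ ?_
  · funext n f
    rcases f with f | f
    · exact congrArg (fun S : L.Structure A => @funMap _ _ S n f) hs
    · exact isEmptyElim f
  · funext n R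
    rcases R with R | R
    · exact congrArg (fun S : L.Structure A => @RelMap _ _ S n R) hs
    · rfl

theorem exists_eq_withRelations (M : Bundled.{0} (L.sum L').Structure) :
    ∃ (A : Type) (_ : L.Structure A) (s : RelFamily L' A), M = withRelations L A s := by
  obtain ⟨A, str⟩ := M
  let A₀ : Bundled.{0} L.Structure :=
    ⟨A, (LHom.sumInl : L →ᴸ L.sum L').reduct A⟩
  obtain ⟨α, hα⟩ := exists_eq_relExpansion (L' := L') A₀ (s := str) rfl
  exact ⟨A, A₀.str, α, by rw [hα]; rfl⟩

variable {A B : Type} [L.Structure A] [L.Structure B] {s : RelFamily L' A} {t : RelFamily L' B}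

/-- An embedding of `L`-structures that pulls back the relations is an embedding of structures in
the expanded language. -/
def extendEmbedding (f : A ↪[L] B) (h : pull f t = s) :
    withRelations L A s ↪[L.sum L'] withRelations L B t where
  toEmbedding := f.toEmbedding
  map_fun' := by
    rintro n (g | g) x
    · exact f.map_fun' g x
    · exact isEmptyElim g
  map_rel' := by
    rintro n (R | R) x
    · exact f.map_rel' R x
    · subst h
      exact Iff.rfl

/-- The reduct of an embedding. -/
def reductEmbedding (f : withRelations L A s ↪[L.sum L'] withRelations L B t) : A ↪[L] B where
  toEmbedding := f.toEmbedding
  map_fun' g x := f.map_fun' (Sum.inl g) x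
  map_rel' R x := f.map_rel' (Sum.inl R) x

/-- The reduct of an isomorphism. -/
def reductEquiv (f : withRelations L A s ≃[L.sum L'] withRelations L B t) : A ≃[L] B where
  toEquiv := f.toEquiv
  map_fun' g x := f.map_fun' (Sum.inl g) x
  map_rel' R x := f.map_rel' (Sum.inl R) x

theorem pull_reductEmbedding (f : withRelations L A s ↪[L.sum L'] withRelations L B t) :
    pull (reductEmbedding f) t = s :=
  funext fun i => funext fun y => propext (f.map_rel' (Sum.inr i.2) y)

theorem pull_reductEquiv (f : withRelations L A s ≃[L.sum L'] withRelations L B t) :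
    pull (reductEquiv f) t = s :=
  funext fun i => funext fun y => propext (f.map_rel' (Sum.inr i.2) y)

/-! ### Ages of expansions in terms of traces -/

variable [L.Structure ℕ]

theorem finite_of_fg_of_embedding (hF : IsFraisseStructure L ℕ)
    (hfg : Structure.FG (L.sum L') (withRelations L A s)) (e : A ↪[L] ℕ) : Finite A := by
  obtain ⟨X, hX, hgen⟩ := Structure.fg_iff.1 hfg
  have hK : Finite (Substructure.closure L (e '' X)) := hF.finite_closure (hX.image e)
  -- As `L'` adds no functions, the pullback of an `L`-substructure is closed in the expanded
  -- language.
  let K : (L.sum L').Substructure (withRelations L A s) :=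
    { carrier := e ⁻¹' (Substructure.closure L (e '' X))
      fun_mem := by
        rintro n (g | g)
        · exact ((Substructure.closure L (e '' X)).comap e.toHom).fun_mem g
        · exact isEmptyElim g }
  have htop : K = ⊤ := top_le_iff.1 (hgen ▸ Substructure.closure_le.2 fun x hx =>
    (Substructure.subset_closure (Set.mem_image_of_mem e hx) :
      e x ∈ Substructure.closure L (e '' X)))
  have hmem : ∀ x : A, e x ∈ Substructure.closure L (e '' X) := fun x =>
    (SetLike.ext_iff.1 htop x).2 trivial
  exact Finite.of_injective (fun x => (⟨e x, hmem x⟩ : Substructure.closure L (e '' X)))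
    fun x y h => e.injective (congrArg Subtype.val h)

instance [Finite A] : Finite (withRelations L A s) := ‹Finite A›

theorem fg_of_finite (L₁ : FirstOrder.Language) (A : Type) [L₁.Structure A] [Finite A] :
    Structure.FG L₁ A :=
  Structure.fg_def.2 (Substructure.FG.of_finite)

theorem mem_age_iff (hF : IsFraisseStructure L ℕ) {S : RelSpace L'} :
    withRelations L A s ∈ (L.sum L').age (expand L S) ↔ Finite A ∧ s ∈ traces L S A := by
  constructor
  · rintro ⟨hfg, ⟨e⟩⟩
    have e' : withRelations L A s ↪[L.sum L'] withRelations L ℕ S := e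
    exact ⟨finite_of_fg_of_embedding hF hfg (reductEmbedding e'), _, pull_reductEmbedding e'⟩
  · rintro ⟨_, a, ha⟩
    exact ⟨fg_of_finite _ _, ⟨extendEmbedding (t := S) a ha⟩⟩

theorem exists_of_mem_age (hF : IsFraisseStructure L ℕ) {S : RelSpace L'}
    {M : Bundled.{0} (L.sum L').Structure} (hM : M ∈ (L.sum L').age (expand L S)) :
    ∃ (A : Type) (_ : L.Structure A) (s : RelFamily L' A), M = withRelations L A s ∧ Finite A ∧
      s ∈ traces L S A := by
  obtain ⟨A, _, s, rfl⟩ := exists_eq_withRelations M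
  exact ⟨A, _, s, rfl, (mem_age_iff hF).1 hM⟩

theorem finite_of_mem_age (hF : IsFraisseStructure L ℕ) {M : Bundled.{0} L.Structure}
    (hM : M ∈ L.age ℕ) : Finite M := by
  obtain ⟨hfg, ⟨e⟩⟩ := hM
  have : Finite e.toHom.range := hF.locallyFinite _ (hfg.range e.toHom)
  exact Finite.of_equiv _ e.equivRange.toEquiv.symm

theorem age_subset_of_below (hF : IsFraisseStructure L ℕ) {S T : RelSpace L'}
    (h : Below L T S) : (L.sum L').age (expand L T) ⊆ (L.sum L').age (expand L S) := by
  intro M hM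
  obtain ⟨A, _, s, rfl, _, hs⟩ := exists_of_mem_age hF hM
  exact (mem_age_iff hF).2 ⟨‹_›, h A hs⟩

theorem finiteTraces_of_finitelyManyExpansions (hF : IsFraisseStructure L ℕ) {R : RelSpace L'}
    (h : FinitelyManyExpansions (L.age ℕ) ((L.sum L').age (expand L R))) : FiniteTraces L R := by
  intro A _ _
  rcases (traces L R A).eq_empty_or_nonempty with h0 | ⟨_, a, -⟩
  · rw [h0]
    exact Set.finite_empty
  · refine ((h (Bundled.of A) ⟨fg_of_finite L A, ⟨a⟩⟩).preimage
      relExpansion_injective.injOn).subset fun s hs => ?_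
    exact ⟨relExpansion_mem_expansionsOf (Bundled.of A) s, (mem_age_iff hF).2 ⟨‹_›, hs⟩⟩

theorem homogeneous_of_isUltrahomogeneous {R : RelSpace L'}
    (h : (L.sum L').IsUltrahomogeneous (expand L R)) : Homogeneous L R := by
  intro A _ _ a a' haa'
  let e : withRelations L A (pull a R) ↪[L.sum L'] expand L R := extendEmbedding (t := R) a rfl
  let e' : withRelations L A (pull a R) ↪[L.sum L'] expand L R :=
    extendEmbedding (t := R) a' haa'.symm
  obtain ⟨g, hg⟩ := h e.toHom.range ((fg_of_finite _ _).range _)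
    (e'.comp e.equivRange.symm.toEmbedding)
  let g' : withRelations L ℕ R ≃[L.sum L'] withRelations L ℕ R := g
  refine ⟨reductEquiv g', pull_reductEquiv g', fun x => ?_⟩
  have := DFunLike.congr_fun hg (e.equivRange x)
  exact (congrArg e' (e.equivRange.symm_apply_apply x)).symm.trans this

theorem embeddingRamsey_of_ramseyProperty (hF : IsFraisseStructure L ℕ) {R : RelSpace L'}
    (hrigid : ConsistsOfRigid ((L.sum L').age (expand L R)))
    (h : RamseyProperty ((L.sum L').age (expand L R))) : EmbeddingRamsey L R R := by
  intro A B _ _ _ _ α hα β hβ k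
  have hA : withRelations L A α ∈ (L.sum L').age (expand L R) := (mem_age_iff hF).2 ⟨‹_›, hα⟩
  obtain ⟨M, hM, harrow⟩ := h k _ hA (withRelations L B β) ((mem_age_iff hF).2 ⟨‹_›, hβ⟩)
  obtain ⟨C, _, γ, rfl, _, c, rfl⟩ := exists_of_mem_age hF hM
  refine ⟨C, _, ‹_›, c, fun χ => ?_⟩
  obtain ⟨b, hb⟩ := harrow.exists_embedding (hrigid _ hA) fun e => χ (reductEmbedding e)
  exact ⟨reductEmbedding b, pull_reductEmbedding b, fun f f' hf hf' =>
    hb (extendEmbedding f hf) (extendEmbedding f' hf')⟩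

theorem ramseyProperty_of_embeddingRamsey (hF : IsFraisseStructure L ℕ) {S T : RelSpace L'}
    (hTS : Below L T S) (h : EmbeddingRamsey L S T) :
    RamseyProperty ((L.sum L').age (expand L S)) := by
  classical
  intro k M hM N hN
  obtain ⟨A, _, α, rfl, _, hα⟩ := exists_of_mem_age hF hM
  obtain ⟨B, _, β, rfl, _, hβ⟩ := exists_of_mem_age hF hN
  -- The extra color is for `L`-embeddings that do not respect the relations; by `key` it never
  -- occurs on the embeddings compared.
  obtain ⟨C, _, _, c, hc⟩ := h A B α hα β hβ (k + 1)
  refine ⟨withRelations L C (pull c T), (mem_age_iff hF).2 ⟨‹_›, hTS C (mem_traces c)⟩,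
    arrow_of_forall_embedding fun χ => ?_⟩
  obtain ⟨b, hb, hχ⟩ := hc fun f =>
    if hf : pull f (pull c T) = α then (χ (extendEmbedding f hf)).castSucc else Fin.last k
  refine ⟨extendEmbedding b (show pull b (pull c T) = β from hb), fun f f' => ?_⟩
  have key : ∀ f : withRelations L A α ↪[L.sum L'] withRelations L B β,
      pull (b.comp (reductEmbedding f)) (pull c T) = α := fun f =>
    (congrArg (pull (reductEmbedding f)) hb).trans (pull_reductEmbedding f)
  have := hχ (reductEmbedding f) (reductEmbedding f') (pull_reductEmbedding f)
    (pull_reductEmbedding f')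
  rw [dif_pos (key f), dif_pos (key f')] at this
  exact Fin.castSucc_injective _ this

theorem expansionProperty_of_traces (hF : IsFraisseStructure L ℕ) {S : RelSpace L'}
    (h : ∀ (A : Type) [L.Structure A] [Finite A], ∃ n, ∀ α ∈ traces L S A,
      ∀ β ∈ traces L S (initialSegment L n), ∃ f : A ↪[L] initialSegment L n, pull f β = α) :
    ExpansionProperty (L.age ℕ) ((L.sum L').age (expand L S)) := by
  intro A hA
  have := finite_of_mem_age hF hA
  obtain ⟨n, hn⟩ := h A
  refine ⟨Bundled.of (initialSegment L n),
    age.fg_substructure (Substructure.fg_closure (Set.finite_Iio n)), fun s hs t ht hsK htK => ?_⟩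
  obtain ⟨α, rfl⟩ := exists_eq_relExpansion _ hs
  obtain ⟨β, rfl⟩ := exists_eq_relExpansion _ ht
  obtain ⟨f, hf⟩ := hn α ((mem_age_iff hF).1 hsK).2 β ((mem_age_iff hF).1 htK).2
  exact ⟨extendEmbedding f hf⟩

theorem isFraisseClass_age (hF : IsFraisseStructure L ℕ) {S : RelSpace L'}
    (hamalg : Amalgamation ((L.sum L').age (expand L S))) :
    IsFraisseClass ((L.sum L').age (expand L S)) where
  isFraisse :=
    have : Countable (expand L S) := inferInstanceAs (Countable ℕ)
    ⟨age.nonempty _, fun _ hN => hN.1, age.countable_quotient _, age.hereditary _,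
      age.jointEmbedding _, hamalg⟩
  finite M hM := by
    obtain ⟨A, _, s, rfl, hA, -⟩ := exists_of_mem_age hF hM
    exact hA
  large n := by
    have := hF.finite_initialSegment n
    refine ⟨withRelations L (initialSegment L n) (pull (initialSegment L n).subtype S),
      (mem_age_iff hF).2 ⟨this, mem_traces _⟩, ?_⟩
    have hinj : Function.Injective fun i : Fin n =>
        (⟨i, mem_initialSegment i.2⟩ : initialSegment L n) := fun i j h =>
      Fin.ext (congrArg Subtype.val h)
    exact (Nat.card_fin n).ge.trans (Nat.card_le_card_of_injective _ hinj)

theorem amalgamation_age (hF : IsFraisseStructure L ℕ) {S T : RelSpace L'} (hTS : Below L T S)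
    (h : ∀ (A B C : Type) [L.Structure A] [L.Structure B] [L.Structure C]
      [Finite A] [Finite B] [Finite C] (f : A ↪[L] B) (h : A ↪[L] C)
      (β : RelFamily L' B) (γ : RelFamily L' C), β ∈ traces L S B → γ ∈ traces L S C →
      pull f β = pull h γ → ∃ (b : B ↪[L] ℕ) (c : C ↪[L] ℕ),
        pull b T = β ∧ pull c T = γ ∧ b.comp f = c.comp h) :
    Amalgamation ((L.sum L').age (expand L S)) := by
  intro M N P f g hM hN hP
  obtain ⟨A, _, α, rfl, _, hα⟩ := exists_of_mem_age hF hM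
  obtain ⟨B, _, β, rfl, _, hβ⟩ := exists_of_mem_age hF hN
  obtain ⟨C, _, γ, rfl, _, hγ⟩ := exists_of_mem_age hF hP
  obtain ⟨b, c, hb, hc, hbc⟩ := h A B C (reductEmbedding f) (reductEmbedding g) β γ hβ hγ
    ((pull_reductEmbedding f).trans (pull_reductEmbedding g).symm)
  -- The amalgam is the substructure generated by both ranges, with the relations of `T`; it is in
  -- the age because `T` is below `S`.
  set Q := b.toHom.range ⊔ c.toHom.range
  have hb' : ∀ x, b x ∈ Q := fun x =>
    (le_sup_left : b.toHom.range ≤ Q) (Hom.mem_range.2 ⟨x, rfl⟩)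
  have hc' : ∀ x, c x ∈ Q := fun x =>
    (le_sup_right : c.toHom.range ≤ Q) (Hom.mem_range.2 ⟨x, rfl⟩)
  have hQ : Finite Q := hF.locallyFinite _
    (((fg_of_finite L B).range _).sup ((fg_of_finite L C).range _))
  refine ⟨withRelations L Q (pull Q.subtype T), extendEmbedding (b.codRestrict Q hb') (show pull _ (pull _ T) = _ from hb),
    extendEmbedding (c.codRestrict Q hc') (show pull _ (pull _ T) = _ from hc), (mem_age_iff hF).2 ⟨hQ, hTS Q (mem_traces _)⟩, ?_⟩
  ext x
  exact Subtype.ext (DFunLike.congr_fun hbc x)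

end Translation

/-! ### Orbit closures -/

section OrbitClosure

variable {L : FirstOrder.Language} {L' : FirstOrder.Language} [L.Structure ℕ]

theorem agreeBelow_of_dist_lt {S T : RelSpace L'} {m : ℕ} (h : dist S T < (1 / 2 : ℝ) ^ m)
    (i : Σ n, L'.Relations n) : AgreeBelow m (S i) (T i) := by
  by_contra hm
  have hne : S i ≠ T i := by
    intro h
    exact hm (h ▸ fun _ _ => Iff.rfl)
  have h1 : (1 / 2 : ℝ) ^ m ≤ relDist (S i) (T i) := by
    rw [relDist, if_neg hne]
    exact pow_le_pow_of_le_one (by norm_num) (by norm_num) (Nat.sInf_le hm)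
  exact absurd (h1.trans (relDist_le_supDist S T i)) (not_le.2 h)

theorem dist_le_of_agreeBelow {S T : RelSpace L'} {m : ℕ}
    (h : ∀ i, AgreeBelow m (S i) (T i)) : dist S T ≤ (1 / 2 : ℝ) ^ m := by
  refine Real.iSup_le (fun i => ?_) (by positivity)
  unfold relDist
  split_ifs with hST
  · positivity
  · refine pow_le_pow_of_le_one (by norm_num) (by norm_num) ?_
    have hne : {n | ¬ AgreeBelow n (S i) (T i)}.Nonempty := by
      by_contra! hc
      exact hST (eq_of_agreeBelow fun n => by
        by_contra hn
        exact (hc ▸ hn : n ∈ (∅ : Set ℕ)))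
    by_contra! hlt
    exact Nat.sInf_mem hne fun y hy => h i y fun j => (hy j).trans hlt

theorem pull_mem_orbit (g : ℕ ≃[L] ℕ) (S : RelSpace L') :
    (pull g S : RelSpace L') ∈ MulAction.orbit (autGroup L) S :=
  ⟨⟨g.symm.toEquiv, g.symm, rfl⟩, rfl⟩

theorem exists_eq_pull_of_mem_orbit {S T : RelSpace L'}
    (h : T ∈ MulAction.orbit (autGroup L) S) : ∃ g : ℕ ≃[L] ℕ, T = pull g S := by
  obtain ⟨⟨_, φ, rfl⟩, rfl⟩ := h
  exact ⟨φ.symm, rfl⟩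

/-- The supremum distance controls all relations at once on initial segments, and ultrahomogeneity
of `F` turns an embedding of such a segment into an automorphism. -/
theorem mem_orbitClosure_iff (hF : IsFraisseStructure L ℕ) {S T : RelSpace L'} :
    T ∈ orbitClosure L S ↔ Below L T S := by
  rw [orbitClosure, Metric.mem_closure_iff]
  constructor
  · rintro h A _ _ _ ⟨a, rfl⟩
    obtain ⟨m, hm⟩ := (Set.finite_range a).bddAbove
    obtain ⟨_, hU, hdist⟩ := h ((1 / 2 : ℝ) ^ (m + 1)) (by positivity)
    obtain ⟨g, rfl⟩ := exists_eq_pull_of_mem_orbit hU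
    refine ⟨g.toEmbedding.comp a, ?_⟩
    funext i y
    exact propext (agreeBelow_of_dist_lt hdist i (a ∘ y) fun j =>
      Nat.lt_succ_of_le (hm (Set.mem_range_self _))).symm
  · intro h ε hε
    obtain ⟨m, hm⟩ := exists_pow_lt_of_lt_one hε (by norm_num : (1 / 2 : ℝ) < 1)
    have := hF.finite_initialSegment m
    obtain ⟨b, hb⟩ := h (initialSegment L m) (mem_traces (initialSegment L m).subtype)
    obtain ⟨g, rfl⟩ := hF.ultrahomogeneous _ (Substructure.fg_closure (Set.finite_Iio m)) b
    refine ⟨_, pull_mem_orbit g S, (dist_le_of_agreeBelow fun i y hy => ?_).trans_lt hm⟩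
    have := congrFun (congrFun hb i) fun j => ⟨y j, mem_initialSegment (hy j)⟩
    exact this.to_iff.symm

theorem isMinimalOrbitClosure_iff (hF : IsFraisseStructure L ℕ) {S : RelSpace L'} :
    IsMinimalOrbitClosure L S ↔ ∀ T : RelSpace L', Below L T S → Below L S T := by
  constructor
  · intro h T hT
    have := h T ((mem_orbitClosure_iff hF).2 hT)
    rw [← mem_orbitClosure_iff hF, this, mem_orbitClosure_iff hF]
    exact Below.refl S
  · intro h T hT
    rw [mem_orbitClosure_iff hF] at hT
    ext U
    rw [mem_orbitClosure_iff hF, mem_orbitClosure_iff hF]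
    exact ⟨fun hU => hU.trans hT, fun hU => hU.trans (h T hT)⟩

end OrbitClosure

end RelExpansion

theorem theorem6
    {L : FirstOrder.Language} {L' : FirstOrder.Language}
    [Countable L.Symbols] [Countable (Σ n, L'.Relations n)] [L'.IsRelational]
    [L.Structure ℕ] (hF : IsFraisseStructure L ℕ)
    (R : RelSpace L') (hFstar : IsFraisseStructure (L.sum L') (expand L R))
    (hprecompact : FinitelyManyExpansions (L.age ℕ) ((L.sum L').age (expand L R)))
    (hrigid : ConsistsOfRigid ((L.sum L').age (expand L R)))
    (hRamsey : RamseyProperty ((L.sum L').age (expand L R))) :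
    (∃ S ∈ orbitClosure L R, IsMinimalOrbitClosure L S) ∧
    ∀ S ∈ orbitClosure L R, IsMinimalOrbitClosure L S →
      (L.sum L').age (expand L S) ⊆ (L.sum L').age (expand L R) ∧
      IsFraisseClass ((L.sum L').age (expand L S)) ∧
      RamseyProperty ((L.sum L').age (expand L S)) ∧
      ExpansionProperty (L.age ℕ) ((L.sum L').age (expand L S)) := by
  have hfin := finiteTraces_of_finitelyManyExpansions hF hprecompact
  have hhom := homogeneous_of_isUltrahomogeneous hFstar.ultrahomogeneous
  have hRam := embeddingRamsey_of_ramseyProperty hF hrigid hRamsey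
  refine ⟨?_, fun S hS hmin => ?_⟩
  · obtain ⟨S, hS, hmin⟩ := exists_minimal_below hfin
    exact ⟨S, (mem_orbitClosure_iff hF).2 hS, (isMinimalOrbitClosure_iff hF).2 hmin⟩
  rw [mem_orbitClosure_iff hF] at hS
  rw [isMinimalOrbitClosure_iff hF] at hmin
  obtain ⟨T, hTS, hT⟩ := exists_invariant_below hF hfin hhom hRam hS
  refine ⟨age_subset_of_below hF hS, isFraisseClass_age hF (amalgamation_age hF hTS ?_),
    ramseyProperty_of_embeddingRamsey hF hTS
      (embeddingRamsey_of_invariant hF hfin hhom hS hmin hTS hT hRam),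
    expansionProperty_of_traces hF (exists_initialSegment_expansion hF hfin hS hmin)⟩
  intro A B C _ _ _ _ _ _ f h β γ hβ hγ hfh
  exact exists_amalgam hF hfin hhom hS hmin hTS hT f h hβ hγ hfh
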